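/- For $\mathbf A\in\mathbb R^{d\times D}$ with columns $\mathbf a_1,\dots,\mathbf a_D$, let $\beta_{\mathbf A}:\mathbb R^{n\times d}\to\mathbb R^{n\times D}$ be the map for which the $k$-th column of $\beta_{\mathbf A}(\mathbf X)$ is $\operatorname{sort}(\mathbf X\mathbf a_k)$, the entries of $\mathbf X\mathbf a_k$ in non-decreasing order. For $\mathbf X,\mathbf Y\in\mathbb R^{n\times d}$ put $\operatorname{dist}(\mathbf X,\mathbf Y)=\min_{\sigma\in S_n}\|\mathbf X-\sigma\mathbf Y\|_{\mathrm F}$, where $S_n$ acts by permuting rows. The lower and upper Lipschitz constants of $\beta_{\mathbf A}$ are the largest $C_1\ge 0$ and the smallest $C_2\ge 0$ with $C_1\operatorname{dist}(\mathbf X,\mathbf Y)\le\|\beta_{\mathbf A}(\mathbf X)-\beta_{\mathbf A}(\mathbf Y)\|_{\mathrm F}\le C_2\operatorname{dist}(\mathbf X,\mathbf Y)$ for all $\mathbf X,\mathbf Y\in\mathbb R^{n\times d}$; the distortion of $\beta_{\mathbf A}$ is $C_2/C_1$ (and $\infty$ if $C_1=0$). There are universal constants $C,K,c_1,c_2>0$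 such that the following holds for all integers $d,n,D\ge 1$ with $D\ge C\,n^4d$. If $\mathbf A\in\mathbb R^{d\times D}$ is a random matrix with independent standard normal entries, then \[ \mathbb P\left\{\forall\,\mathbf X,\mathbf Y\in\mathbb R^{n\times d}:\ \|\beta_{\mathbf A}(\mathbf X)-\beta_{\mathbf A}(\mathbf Y)\|_{\mathrm F}\ \ge\ \frac{\sqrt{2\pi}}{9\sqrt 3}\,\frac{\sqrt D}{n^2}\,\operatorname{dist}(\mathbf X,\mathbf Y)\right\}\ \ge\ 1-\exp\left(-\frac{8}{81}\,\frac{D}{n^4}\right), \] and, with probability at least $1-2\exp(-c_1D)-\exp(-c_2\,n^{-4}D)$, the distortion of $\beta_{\mathbf A}$ is at most $K n^2$. -/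

import Mathlib

open MeasureTheory ProbabilityTheory
open scoped NNReal ENNReal Matrix Matrix.Norms.Frobenius

/-- The entries of `v` arranged in non-decreasing order. -/
noncomputable def sortVec {n : ℕ} (v : Fin n → ℝ) : Fin n → ℝ :=
  v ∘ Tuple.sort v

/-- The sorting embedding `β_A`: the `k`-th column of `β_A(X)` is `sort(X a_k)`, where `a_k` is the
`k`-th column of `A`. -/
noncomputable def sortEmbedding {n d D : ℕ} (A : Matrix (Fin d) (Fin D) ℝ) (X : Matrix (Fin n) (Fin d) ℝ) :
    Matrix (Fin n) (Fin D) ℝ :=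
  Matrix.of fun i k => sortVec (X *ᵥ A.col k) i

/-- `dist(X, Y)`, the minimum over all row permutations `σ` of the Frobenius norm of `X - σ Y`. -/
noncomputable def orbitDist {n d : ℕ} (X Y : Matrix (Fin n) (Fin d) ℝ) : ℝ :=
  Finset.univ.inf' Finset.univ_nonempty fun σ : Equiv.Perm (Fin n) => ‖X - Y.submatrix σ id‖

/-- The lower Lipschitz constant of the map induced by `β_A` on `ℝ^{n × d} / S_n`: the largest `c`
with `c * dist(X, Y) ≤ ‖β_A(X) - β_A(Y)‖` for all `X, Y`. -/
noncomputable def lowerLipschitzConst (n : ℕ) {d D : ℕ} (A : Matrix (Fin d) (Fin D) ℝ) : ℝ≥0∞ :=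
  ⨆ (c : ℝ≥0) (_ : ∀ X Y : Matrix (Fin n) (Fin d) ℝ,
    (c : ℝ) * orbitDist X Y ≤ ‖sortEmbedding A X - sortEmbedding A Y‖), (c : ℝ≥0∞)

/-- The upper Lipschitz constant of the map induced by `β_A` on `ℝ^{n × d} / S_n`: the smallest `c`
with `‖β_A(X) - β_A(Y)‖ ≤ c * dist(X, Y)` for all `X, Y`. -/
noncomputable def upperLipschitzConst (n : ℕ) {d D : ℕ} (A : Matrix (Fin d) (Fin D) ℝ) : ℝ≥0∞ :=
  ⨅ (c : ℝ≥0) (_ : ∀ X Y : Matrix (Fin n) (Fin d) ℝ,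
    ‖sortEmbedding A X - sortEmbedding A Y‖ ≤ (c : ℝ) * orbitDist X Y), (c : ℝ≥0∞)

open Classical in
/-- The distortion, i.e. the quotient of the upper and the lower Lipschitz constant; it is infinite
when the lower Lipschitz constant vanishes (also for `A = 0`, where both constants vanish). -/
noncomputable def distortion (n : ℕ) {d D : ℕ} (A : Matrix (Fin d) (Fin D) ℝ) : ℝ≥0∞ :=
  if lowerLipschitzConst n A = 0 then ⊤ else upperLipschitzConst n A / lowerLipschitzConst n A

/-- `A` is a random matrix whose entries are independent standard normal random variables. -/
structure IsStdGaussianMatrix {Ω : Type*} [MeasurableSpace Ω] (P : Measure Ω) {d D : ℕ}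
    (A : Ω → Matrix (Fin d) (Fin D) ℝ) : Prop where
  hasLaw : ∀ i k, HasLaw (fun ω => A ω i k) (gaussianReal 0 1) P
  indep : iIndepFun (fun (p : Fin d × Fin D) ω => A ω p.1 p.2) P

/-! ### Sorting and row permutations -/

/-! Upper bound: sorting is 1-Lipschitz by the rearrangement inequality, so `‖colMap A‖` is an upper
Lipschitz constant (`norm_sortEmbedding_sub_le`).

Lower bound: sorting matches the rows of `X` and `Y` by some permutation in each column. If `a_k`
satisfies `|⟨z, a_k⟩| ≥ t ‖z‖` for all `n ^ 2` row differences `z`, column `k` contributes at least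
`t ^ 2 * dist ^ 2`, whatever that permutation is. If each direction rules out at most `(2 / 3) D / n
^ 2` columns, at least `D / 3` survive (`sqrt_mul_orbitDist_le`). This gives the constant `t √(D /
3)`, with `t = √(2π) / (9 n ^ 2)`.

Probability: for fixed unit `z`, the `⟨z, a_k⟩` are independent standard normals, so Chernoff bounds
control both the number of small ones and `‖Aᵀ z‖`. A union bound over a net of the sphere and a
perturbation argument give uniformity in `z` (`exists_event_colMap_bounds`). A single event serves
both claims. -/

lemma sum_sq_sortVec_sub_le {n : ℕ} (u v : Fin n → ℝ) :
    ∑ i, (sortVec u i - sortVec v i) ^ 2 ≤ ∑ i, (u i - v i) ^ 2 := by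
  set σ := Tuple.sort u
  set τ := Tuple.sort v
  have hmono : Monovary (u ∘ σ) (v ∘ τ) :=
    (Tuple.monotone_sort u).monovary (Tuple.monotone_sort v)
  -- Rearrangement inequality: sorting both vectors maximizes the inner product and preserves the
  -- norms.
  have hcross : ∑ i, u i * v i ≤ ∑ i, (u ∘ σ) i * (v ∘ τ) i := by
    have h := hmono.sum_mul_comp_perm_le_sum_mul (σ := τ⁻¹ * σ)
    calc ∑ i, u i * v i = ∑ i, u (σ i) * v (σ i) := (Equiv.sum_comp σ fun i => u i * v i).symm
      _ ≤ _ := by simpa using h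
  have hu : ∑ i, (u ∘ σ) i ^ 2 = ∑ i, u i ^ 2 := Equiv.sum_comp σ fun i => u i ^ 2
  have hv : ∑ i, (v ∘ τ) i ^ 2 = ∑ i, v i ^ 2 := Equiv.sum_comp τ fun i => v i ^ 2
  have expand : ∀ a b : Fin n → ℝ,
      ∑ i, (a i - b i) ^ 2 = ∑ i, a i ^ 2 - 2 * ∑ i, a i * b i + ∑ i, b i ^ 2 := fun a b => by
    rw [Finset.mul_sum, ← Finset.sum_sub_distrib, ← Finset.sum_add_distrib]
    exact Finset.sum_congr rfl fun i _ => by ring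
  have h1 := expand (u ∘ σ) (v ∘ τ)
  have h2 := expand u v
  change ∑ i, ((u ∘ σ) i - (v ∘ τ) i) ^ 2 ≤ _
  linarith

lemma sortVec_comp_perm {n : ℕ} (v : Fin n → ℝ) (σ : Equiv.Perm (Fin n)) :
    sortVec (v ∘ σ) = sortVec v :=
  Tuple.comp_perm_comp_sort_eq_comp_sort

/-- Entries of equal rank are matched. The permutation will vary with the column, which is harmless
since `orbitDist_le` holds for every permutation. -/
lemma exists_perm_sum_sq_sortVec_sub_eq {n : ℕ} (u v : Fin n → ℝ) :
    ∃ σ : Equiv.Perm (Fin n),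
      ∑ i, (sortVec u i - sortVec v i) ^ 2 = ∑ i, (u i - v (σ i)) ^ 2 := by
  refine ⟨Tuple.sort v * (Tuple.sort u)⁻¹, ?_⟩
  rw [← Equiv.sum_comp (Tuple.sort u) fun i => (u i - v _) ^ 2]
  simp [sortVec]

lemma frobenius_norm_sq {m n : Type*} [Fintype m] [Fintype n] (A : Matrix m n ℝ) :
    ‖A‖ ^ 2 = ∑ i, ∑ j, A i j ^ 2 := by
  rw [Matrix.frobenius_norm_def, ← Real.sqrt_eq_rpow, Real.sq_sqrt (by positivity)]
  simp

lemma orbitDist_nonneg {n d : ℕ} (X Y : Matrix (Fin n) (Fin d) ℝ) : 0 ≤ orbitDist X Y :=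
  Finset.le_inf' _ _ fun _ _ => norm_nonneg _

lemma orbitDist_le {n d : ℕ} (X Y : Matrix (Fin n) (Fin d) ℝ) (σ : Equiv.Perm (Fin n)) :
    orbitDist X Y ≤ ‖X - Y.submatrix σ id‖ :=
  Finset.inf'_le _ (Finset.mem_univ σ)

lemma exists_orbitDist_eq {n d : ℕ} (X Y : Matrix (Fin n) (Fin d) ℝ) :
    ∃ σ : Equiv.Perm (Fin n), orbitDist X Y = ‖X - Y.submatrix σ id‖ := by
  obtain ⟨σ, -, h⟩ := Finset.exists_mem_eq_inf' Finset.univ_nonempty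
    fun σ : Equiv.Perm (Fin n) => ‖X - Y.submatrix σ id‖
  exact ⟨σ, h⟩

/-! ### The map `z ↦ (⟨z, a_k⟩)_k` attached to a matrix with columns `a_k` -/

/-- The linear map `z ↦ Aᵀ z` between Euclidean spaces. -/
noncomputable def colMap {d D : ℕ} (A : Matrix (Fin d) (Fin D) ℝ) :
    EuclideanSpace ℝ (Fin d) →L[ℝ] EuclideanSpace ℝ (Fin D) :=
  LinearMap.toContinuousLinearMap (Matrix.toLpLin 2 2 Aᵀ)

lemma colMap_apply {d D : ℕ} (A : Matrix (Fin d) (Fin D) ℝ) (z : EuclideanSpace ℝ (Fin d))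
    (k : Fin D) : colMap A z k = ∑ i, z i * A i k := by
  simp [colMap, Matrix.toLpLin_apply, Matrix.mulVec, dotProduct, mul_comm]

/-- The difference of the `i`-th row of `X` and the `j`-th row of `Y`. -/
noncomputable def rowDiff {n d : ℕ} (X Y : Matrix (Fin n) (Fin d) ℝ) (i j : Fin n) :
    EuclideanSpace ℝ (Fin d) :=
  WithLp.toLp 2 (X i - Y j)

lemma colMap_rowDiff {n d D : ℕ} (A : Matrix (Fin d) (Fin D) ℝ) (X Y : Matrix (Fin n) (Fin d) ℝ)
    (i j : Fin n) (k : Fin D) :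
    colMap A (rowDiff X Y i j) k = (X *ᵥ A.col k) i - (Y *ᵥ A.col k) j := by
  simp [colMap_apply, rowDiff, Matrix.mulVec, dotProduct]

lemma norm_sq_sub_submatrix {n d : ℕ} (X Y : Matrix (Fin n) (Fin d) ℝ) (σ : Equiv.Perm (Fin n)) :
    ‖X - Y.submatrix σ id‖ ^ 2 = ∑ i, ‖rowDiff X Y i (σ i)‖ ^ 2 := by
  simp [frobenius_norm_sq, EuclideanSpace.norm_sq_eq, rowDiff]

lemma norm_sq_sortEmbedding_sub {n d D : ℕ} (A : Matrix (Fin d) (Fin D) ℝ)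
    (X Y : Matrix (Fin n) (Fin d) ℝ) :
    ‖sortEmbedding A X - sortEmbedding A Y‖ ^ 2 =
      ∑ k, ∑ i, (sortVec (X *ᵥ A.col k) i - sortVec (Y *ᵥ A.col k) i) ^ 2 := by
  rw [frobenius_norm_sq, Finset.sum_comm]
  simp [sortEmbedding]

lemma norm_sortEmbedding_sub_le {n d D : ℕ} (A : Matrix (Fin d) (Fin D) ℝ)
    (X Y : Matrix (Fin n) (Fin d) ℝ) :
    ‖sortEmbedding A X - sortEmbedding A Y‖ ≤ ‖colMap A‖ * orbitDist X Y := by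
  obtain ⟨σ, hσ⟩ := exists_orbitDist_eq X Y
  rw [hσ]
  refine le_of_sq_le_sq ?_ (by positivity)
  rw [norm_sq_sortEmbedding_sub, mul_pow, norm_sq_sub_submatrix, Finset.mul_sum]
  calc ∑ k, ∑ i, (sortVec (X *ᵥ A.col k) i - sortVec (Y *ᵥ A.col k) i) ^ 2
      ≤ ∑ k, ∑ i, (colMap A (rowDiff X Y i (σ i)) k) ^ 2 := by
        refine Finset.sum_le_sum fun k _ => ?_
        simp_rw [colMap_rowDiff]
        rw [← sortVec_comp_perm (Y *ᵥ A.col k) σ]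
        exact sum_sq_sortVec_sub_le _ _
    _ = ∑ i, ‖colMap A (rowDiff X Y i (σ i))‖ ^ 2 := by
        rw [Finset.sum_comm]
        simp [EuclideanSpace.norm_sq_eq]
    _ ≤ ∑ i, ‖colMap A‖ ^ 2 * ‖rowDiff X Y i (σ i)‖ ^ 2 := by
        refine Finset.sum_le_sum fun i _ => ?_
        rw [← mul_pow]
        gcongr
        exact (colMap A).le_opNorm _

/-! ### Lower Lipschitz bound by counting nearly orthogonal columns. -/

/-- The number of coordinates of `v` of absolute value less than `t`. -/
noncomputable def smallCount {D : ℕ} (t : ℝ) (v : Fin D → ℝ) : ℝ :=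
  ∑ k, Set.indicator {x : ℝ | |x| < t} 1 (v k)

/-- A Chebyshev count: where `v` is below `t` but `w` is not below `t + η`, they differ by at least
`η`. This carries counts from a net to the whole sphere. -/
lemma smallCount_le_add {D : ℕ} {t η : ℝ} (hη : 0 < η) (v w : EuclideanSpace ℝ (Fin D)) :
    smallCount t v ≤ smallCount (t + η) w + ‖v - w‖ ^ 2 / η ^ 2 := by
  rw [EuclideanSpace.norm_sq_eq, Finset.sum_div, smallCount, smallCount, ← Finset.sum_add_distrib]
  refine Finset.sum_le_sum fun k _ => ?_
  simp only [PiLp.sub_apply, Real.norm_eq_abs, sq_abs]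
  have hnn : 0 ≤ (v k - w k) ^ 2 / η ^ 2 := by positivity
  by_cases hv : |v k| < t
  · by_cases hw : |w k| < t + η
    · simp [hv, hw, hnn]
    · have h1 : η ≤ |v k - w k| := by
        have := abs_sub_abs_le_abs_sub (w k) (v k)
        rw [abs_sub_comm] at this
        linarith [not_lt.1 hw]
      have : 1 ≤ (v k - w k) ^ 2 / η ^ 2 := by
        rw [one_le_div (by positivity), ← sq_abs (v k - w k)]
        gcongr
      simpa [hv, hw] using this
  · have : 0 ≤ Set.indicator {x : ℝ | |x| < t + η} (1 : ℝ → ℝ) (w k) :=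
      Set.indicator_nonneg (fun _ _ => zero_le_one) _
    simp only [Set.indicator, Set.mem_ofPred_eq, hv, if_false] at this ⊢
    linarith

/-- If every unit vector is nearly orthogonal to few columns of `A`, then many columns of `A` are
nearly orthogonal to none of the differences of rows of `X` and of `Y`. -/
lemma sqrt_mul_orbitDist_le {n d D : ℕ} (hn : 1 ≤ n) (A : Matrix (Fin d) (Fin D) ℝ) {t : ℝ}
    (ht : 0 ≤ t)
    (hA : ∀ z : EuclideanSpace ℝ (Fin d), ‖z‖ = 1 →
      smallCount t (colMap A z) ≤ 2 / 3 * ((D : ℝ) / (n : ℝ) ^ 2))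
    (X Y : Matrix (Fin n) (Fin d) ℝ) :
    t * √((D : ℝ) / 3) * orbitDist X Y ≤ ‖sortEmbedding A X - sortEmbedding A Y‖ := by
  have hdist := orbitDist_nonneg X Y
  refine le_of_sq_le_sq ?_ (norm_nonneg _)
  rw [mul_pow, mul_pow, Real.sq_sqrt (by positivity), norm_sq_sortEmbedding_sub]
  set bad : Fin n → Fin n → Fin D → ℝ := fun i j k =>
    if |colMap A (rowDiff X Y i j) k| < t * ‖rowDiff X Y i j‖ then 1 else 0 with hbad
  have hbad_nonneg : ∀ i j k, 0 ≤ bad i j k := fun i j k => by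
    simp only [hbad]; split_ifs <;> simp
  have hcount : ∀ i j, ∑ k, bad i j k ≤ 2 / 3 * ((D : ℝ) / (n : ℝ) ^ 2) := fun i j => by
    -- A zero difference is never bad because the inequality in `bad` is strict; any other is
    -- normalized.
    rcases eq_or_ne (rowDiff X Y i j) 0 with h0 | h0
    · simp only [hbad, h0]
      simp
      positivity
    · have hpos : 0 < ‖rowDiff X Y i j‖ := norm_pos_iff.2 h0
      refine le_trans (Finset.sum_le_sum fun k _ => ?_)
        (hA (‖rowDiff X Y i j‖⁻¹ • rowDiff X Y i j) (by rw [norm_smul]; simp [hpos.ne']))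
      simp only [hbad, map_smul, PiLp.smul_apply, smul_eq_mul, Set.indicator, Set.mem_ofPred_eq,
        abs_mul, abs_inv, abs_norm, Pi.one_apply]
      have : ‖rowDiff X Y i j‖⁻¹ * |colMap A (rowDiff X Y i j) k| < t ↔
          |colMap A (rowDiff X Y i j) k| < t * ‖rowDiff X Y i j‖ := by
        rw [inv_mul_lt_iff₀ hpos, mul_comm]
      simp [this]
  -- A union bound per column: the factor is nonpositive once some pair is bad and at most 1
  -- otherwise, so after summing over `k` only the total number of bad triples matters.
  have hcol : ∀ k, (1 - ∑ i, ∑ j, bad i j k) * (t ^ 2 * orbitDist X Y ^ 2) ≤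
      ∑ i, (sortVec (X *ᵥ A.col k) i - sortVec (Y *ᵥ A.col k) i) ^ 2 := fun k => by
    have hsq : 0 ≤ t ^ 2 * orbitDist X Y ^ 2 := by positivity
    by_cases hk : ∃ i j, bad i j k = 1
    · obtain ⟨i, j, hij⟩ := hk
      have h1 : 1 ≤ ∑ i, ∑ j, bad i j k := by
        rw [← hij]
        exact (Finset.single_le_sum (f := fun j => bad i j k) (fun j _ => hbad_nonneg i j k)
          (Finset.mem_univ j)).trans (Finset.single_le_sum (f := fun i => ∑ j, bad i j k)
            (fun i _ => Finset.sum_nonneg fun j _ => hbad_nonneg i j k) (Finset.mem_univ i))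
      exact (mul_nonpos_of_nonpos_of_nonneg (by linarith) hsq).trans (by positivity)
    · push Not at hk
      have hgood : ∀ i j, t * ‖rowDiff X Y i j‖ ≤ |colMap A (rowDiff X Y i j) k| := fun i j => by
        by_contra! h
        exact hk i j (by simp [hbad, h])
      obtain ⟨σ, hσ⟩ := exists_perm_sum_sq_sortVec_sub_eq (X *ᵥ A.col k) (Y *ᵥ A.col k)
      rw [hσ]
      calc (1 - ∑ i, ∑ j, bad i j k) * (t ^ 2 * orbitDist X Y ^ 2)
          ≤ t ^ 2 * orbitDist X Y ^ 2 := mul_le_of_le_one_left hsq <| sub_le_self _ <|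
            Finset.sum_nonneg fun i _ => Finset.sum_nonneg fun j _ => hbad_nonneg i j k
        _ ≤ t ^ 2 * ‖X - Y.submatrix σ id‖ ^ 2 := by
            gcongr
            exact orbitDist_le X Y σ
        _ = ∑ i, (t * ‖rowDiff X Y i (σ i)‖) ^ 2 := by
            rw [norm_sq_sub_submatrix, Finset.mul_sum]
            simp_rw [mul_pow]
        _ ≤ ∑ i, |colMap A (rowDiff X Y i (σ i)) k| ^ 2 := by
            gcongr with i
            exact hgood i (σ i)
        _ = _ := by simp [colMap_rowDiff]
  refine le_trans ?_ (Finset.sum_le_sum fun k _ => hcol k)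
  rw [← Finset.sum_mul, Finset.sum_sub_distrib]
  have hsum : ∑ k, ∑ i, ∑ j, bad i j k ≤ 2 / 3 * (D : ℝ) := by
    calc ∑ k, ∑ i, ∑ j, bad i j k = ∑ i, ∑ j, ∑ k, bad i j k := by
          rw [Finset.sum_comm]
          exact Finset.sum_congr rfl fun i _ => Finset.sum_comm
      _ ≤ ∑ _i : Fin n, ∑ _j : Fin n, 2 / 3 * ((D : ℝ) / (n : ℝ) ^ 2) :=
          Finset.sum_le_sum fun i _ => Finset.sum_le_sum fun j _ => hcount i j
      _ = 2 / 3 * (D : ℝ) := by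
          have : (n : ℝ) ≠ 0 := by positivity
          simp
          field_simp
  have : (D : ℝ) / 3 ≤ ∑ _k : Fin D, (1 : ℝ) - ∑ k, ∑ i, ∑ j, bad i j k := by
    simp only [Finset.sum_const, Finset.card_univ, Fintype.card_fin, nsmul_eq_mul, mul_one]
    linarith
  calc t ^ 2 * ((D : ℝ) / 3) * orbitDist X Y ^ 2
      = (D : ℝ) / 3 * (t ^ 2 * orbitDist X Y ^ 2) := by ring
    _ ≤ _ := by gcongr

/-! ### Nets of the unit sphere -/

/-- Volume comparison: the balls of radius `ε / 2` about the points are disjoint and lie in the ball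
of radius `1 + ε / 2`. -/
lemma card_le_of_separated_of_norm_le_one {E : Type*} [NormedAddCommGroup E] [NormedSpace ℝ E]
    [FiniteDimensional ℝ E] {ε : ℝ} (hε : 0 < ε) (s : Finset E) (hs : ∀ x ∈ s, ‖x‖ ≤ 1)
    (hsep : ∀ x ∈ s, ∀ y ∈ s, x ≠ y → ε ≤ ‖x - y‖) :
    (s.card : ℝ) ≤ (1 + 2 / ε) ^ Module.finrank ℝ E := by
  borelize E
  let μ : Measure E := Measure.addHaar
  have hδ : 0 < ε / 2 := by positivity
  have hρ : 0 < 1 + ε / 2 := by positivity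
  have hdisj : Set.PairwiseDisjoint (s : Set E) fun x => Metric.ball x (ε / 2) := by
    intro x hx y hy hxy
    refine Metric.ball_disjoint_ball ?_
    rw [dist_eq_norm]
    linarith [hsep x hx y hy hxy]
  have hsub : (⋃ x ∈ s, Metric.ball x (ε / 2)) ⊆ Metric.ball (0 : E) (1 + ε / 2) := by
    refine Set.iUnion₂_subset fun x hx => Metric.ball_subset_ball' ?_
    rw [dist_zero_right]
    linarith [hs x hx]
  have hμ := measure_mono (μ := μ) hsub
  rw [measure_biUnion_finset hdisj fun _ _ => measurableSet_ball] at hμ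
  simp only [μ.addHaar_ball_of_pos _ hδ, μ.addHaar_ball_of_pos _ hρ, Finset.sum_const,
    nsmul_eq_mul, ← mul_assoc] at hμ
  have hcancel := (ENNReal.mul_le_mul_iff_left
    (Metric.measure_ball_pos μ (0 : E) zero_lt_one).ne' measure_ball_lt_top.ne).1 hμ
  have hreal := ENNReal.toReal_le_of_le_ofReal (by positivity) hcancel
  rw [ENNReal.toReal_mul, ENNReal.toReal_natCast, ENNReal.toReal_ofReal (by positivity),
    ← le_div_iff₀ (by positivity), ← div_pow] at hreal
  have hbase : 1 + 2 / ε = (1 + ε / 2) / (ε / 2) := by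
    field_simp
    ring
  rwa [hbase]

/-- A separated set of maximal cardinality is a net, since an uncovered point could be added. The
volume bound ensures that a maximum exists. -/
lemma exists_sphere_net {E : Type*} [NormedAddCommGroup E] [NormedSpace ℝ E]
    [FiniteDimensional ℝ E] {ε : ℝ} (hε : 0 < ε) :
    ∃ S : Finset E, (∀ x ∈ S, ‖x‖ = 1) ∧ (∀ z : E, ‖z‖ = 1 → ∃ x ∈ S, ‖z - x‖ ≤ ε) ∧
      (S.card : ℝ) ≤ (1 + 2 / ε) ^ Module.finrank ℝ E := by
  classical
  let good : Finset E → Prop := fun s =>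
    (∀ x ∈ s, ‖x‖ = 1) ∧ ∀ x ∈ s, ∀ y ∈ s, x ≠ y → ε ≤ ‖x - y‖
  have hcard : ∀ s, good s → (s.card : ℝ) ≤ (1 + 2 / ε) ^ Module.finrank ℝ E := fun s hs =>
    card_le_of_separated_of_norm_le_one hε s (fun x hx => (hs.1 x hx).le) hs.2
  let p : ℕ → Prop := fun m => ∃ s, good s ∧ s.card = m
  have hp0 : p 0 := ⟨∅, by simp [good], rfl⟩
  obtain ⟨S, hS, hScard⟩ : p (Nat.findGreatest p ⌊(1 + 2 / ε) ^ Module.finrank ℝ E⌋₊) :=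
    Nat.findGreatest_spec (Nat.zero_le _) hp0
  refine ⟨S, hS.1, fun z hz => ?_, hcard S hS⟩
  by_contra! hfar
  have hzS : z ∉ S := fun h => by simpa using hε.trans (hfar z h)
  have hgood : good (insert z S) := by
    refine ⟨by simpa [hz] using hS.1, fun x hx y hy hxy => ?_⟩
    rcases Finset.mem_insert.1 hx with rfl | hx <;> rcases Finset.mem_insert.1 hy with rfl | hy
    · exact absurd rfl hxy
    · exact (hfar y hy).le
    · rw [norm_sub_rev]; exact (hfar x ‹_›).le
    · exact hS.2 x hx y hy hxy
  have := Nat.le_findGreatest (P := p) (Nat.le_floor (hcard _ hgood)) ⟨_, hgood, rfl⟩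
  rw [← hScard, Finset.card_insert_of_notMem hzS] at this
  omega

lemma opNorm_le_of_net {E F : Type*} [NormedAddCommGroup E] [NormedSpace ℝ E]
    [NormedAddCommGroup F] [NormedSpace ℝ F] (T : E →L[ℝ] F) {S : Finset E} {R : ℝ} (hR : 0 ≤ R)
    (hnet : ∀ z : E, ‖z‖ = 1 → ∃ x ∈ S, ‖z - x‖ ≤ 1 / 2) (hT : ∀ x ∈ S, ‖T x‖ ≤ R) :
    ‖T‖ ≤ 2 * R := by
  have hunit : ∀ z : E, ‖z‖ = 1 → ‖T z‖ ≤ R + ‖T‖ / 2 := fun z hz => by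
    obtain ⟨x, hx, hzx⟩ := hnet z hz
    calc ‖T z‖ = ‖T x + T (z - x)‖ := by simp
      _ ≤ ‖T x‖ + ‖T‖ * ‖z - x‖ := (norm_add_le _ _).trans (by gcongr; exact T.le_opNorm _)
      _ ≤ R + ‖T‖ * (1 / 2) := by gcongr; exact hT x hx
      _ = _ := by ring
  have : ‖T‖ ≤ R + ‖T‖ / 2 := T.opNorm_le_of_unit_norm (by positivity) hunit
  linarith

/-! ### Chernoff bounds for Gaussian vectors -/

/-- Markov's inequality for the exponential of the sum, whose integral factors over the product
measure. -/
lemma measureReal_pi_ge_le {ι : Type*} [Fintype ι] (μ : Measure ℝ) [IsProbabilityMeasure μ]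
    {f : ℝ → ℝ} (hf : Integrable (fun x => Real.exp (f x)) μ) (c : ℝ) :
    (Measure.pi fun _ : ι => μ).real {y | c ≤ ∑ i, f (y i)} ≤
      Real.exp (-c) * (∫ x, Real.exp (f x) ∂μ) ^ Fintype.card ι := by
  have hint : Integrable (fun y : ι → ℝ => Real.exp (∑ i, f (y i))) (Measure.pi fun _ => μ) := by
    simp_rw [Real.exp_sum]
    exact Integrable.fintype_prod fun _ => hf
  have hval : ∫ y : ι → ℝ, Real.exp (∑ i, f (y i)) ∂(Measure.pi fun _ => μ) =
      (∫ x, Real.exp (f x) ∂μ) ^ Fintype.card ι := by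
    simp_rw [Real.exp_sum]
    exact integral_fintype_prod_eq_pow (μ := μ) fun x => Real.exp (f x)
  have hM := mul_meas_ge_le_integral_of_nonneg
    (Filter.Eventually.of_forall fun y => (Real.exp_pos _).le) hint (Real.exp c)
  simp only [Real.exp_le_exp] at hM
  rw [hval, ← le_div_iff₀' (Real.exp_pos _)] at hM
  rw [Real.exp_neg, inv_mul_eq_div]
  exact hM

lemma gaussianReal_abs_lt_le (s : ℝ) (hs : 0 ≤ s) :
    (gaussianReal 0 1).real {x | |x| < s} ≤ 2 * s / √(2 * Real.pi) := by
  have hset : {x : ℝ | |x| < s} = Set.Ioo (-s) s := by ext; simp [abs_lt]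
  have hpdf : ∀ x, gaussianPDFReal 0 1 x ≤ (√(2 * Real.pi))⁻¹ := fun x => by
    rw [gaussianPDFReal]
    simp only [NNReal.coe_one, mul_one, sub_zero]
    refine mul_le_of_le_one_right (by positivity) (Real.exp_le_one_iff.2 ?_)
    have := sq_nonneg x
    linarith
  rw [hset, measureReal_def, gaussianReal_apply_eq_integral _ one_ne_zero,
    ENNReal.toReal_ofReal (integral_nonneg fun x => gaussianPDFReal_nonneg _ _ x)]
  calc ∫ x in Set.Ioo (-s) s, gaussianPDFReal 0 1 x
      ≤ ∫ _ in Set.Ioo (-s) s, (√(2 * Real.pi))⁻¹ :=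
        setIntegral_mono (integrable_gaussianPDFReal _ _).integrableOn
          (integrableOn_const measure_Ioo_lt_top.ne) hpdf
    _ = _ := by
        simp [Real.volume_real_Ioo_of_le (show -s ≤ s by linarith)]
        ring

lemma integrable_exp_sq_div_four_gaussianReal :
    Integrable (fun x => Real.exp (x ^ 2 / 4)) (gaussianReal 0 1) ∧
      ∫ x, Real.exp (x ^ 2 / 4) ∂gaussianReal 0 1 = √2 := by
  have hmul : ∀ x, gaussianPDFReal 0 1 x * Real.exp (x ^ 2 / 4) =
      (√(2 * Real.pi))⁻¹ * Real.exp (-(1 / 4) * x ^ 2) := fun x => by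
    rw [gaussianPDFReal, mul_assoc, ← Real.exp_add]
    simp only [NNReal.coe_one, mul_one, sub_zero]
    congr 2
    ring
  constructor
  · rw [gaussianReal_of_var_ne_zero _ one_ne_zero,
      integrable_withDensity_iff_integrable_smul' (measurable_gaussianPDF _ _)
        (Filter.Eventually.of_forall fun _ => gaussianPDF_lt_top)]
    simp only [toReal_gaussianPDF, smul_eq_mul, hmul]
    exact (integrable_exp_neg_mul_sq (by norm_num)).const_mul _
  · rw [integral_gaussianReal_eq_integral_smul one_ne_zero]
    simp only [smul_eq_mul, hmul]
    rw [integral_const_mul, integral_gaussian, inv_mul_eq_div, ← Real.sqrt_div' _ (by positivity)]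
    congr 1
    field_simp
    norm_num

/-- The coordinates are jointly Gaussian, being linear in the entries, and their covariance matrix
is `‖z‖ ^ 2` times the identity. For jointly Gaussian variables, zero covariance gives independence.
-/
lemma IsStdGaussianMatrix.hasLaw_colMap {Ω : Type*} [MeasurableSpace Ω] {P : Measure Ω}
    [IsProbabilityMeasure P] {d D : ℕ} {A : Ω → Matrix (Fin d) (Fin D) ℝ}
    (hA : IsStdGaussianMatrix P A) {z : EuclideanSpace ℝ (Fin d)} (hz : ‖z‖ = 1) :
    HasLaw (fun ω k => colMap (A ω) z k) (Measure.pi fun _ => gaussianReal 0 1) P := by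
  have hentry : ∀ i k, HasGaussianLaw (fun ω => A ω i k) P := fun i k =>
    (hA.hasLaw i k).hasGaussianLaw
  have hmem : ∀ i k, MemLp (fun ω => A ω i k) 2 P := fun i k => (hentry i k).memLp_two
  have hjoint : HasGaussianLaw (fun ω (p : Fin d × Fin D) => A ω p.1 p.2) P :=
    hA.indep.hasGaussianLaw fun p => hentry p.1 p.2
  have hcov : ∀ i j k l, cov[fun ω => A ω i k, fun ω => A ω j l; P] =
      if (i, k) = (j, l) then 1 else 0 := fun i j k l => by
    split_ifs with h
    · obtain ⟨rfl, rfl⟩ := Prod.mk.inj h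
      rw [covariance_self (hA.hasLaw i k).aemeasurable, (hA.hasLaw i k).variance_eq,
        variance_id_gaussianReal]
      simp
    · exact (hA.indep.indepFun h).covariance_eq_zero (hmem i k) (hmem j l)
  let L : (Fin d × Fin D → ℝ) →L[ℝ] (Fin D → ℝ) :=
    LinearMap.toContinuousLinearMap
      { toFun := fun a k => ∑ i, z i * a (i, k)
        map_add' := fun a b => by ext k; simp [mul_add, Finset.sum_add_distrib]
        map_smul' := fun c a => by
          ext k
          simp only [Pi.smul_apply, smul_eq_mul, RingHom.id_apply, Finset.mul_sum]
          exact Finset.sum_congr rfl fun i _ => by ring }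
  have hY : HasGaussianLaw (fun ω k => colMap (A ω) z k) P := by
    have := hjoint.map_fun L
    simpa [L, colMap_apply] using! this
  have hcovY : ∀ k l, cov[fun ω => colMap (A ω) z k, fun ω => colMap (A ω) z l; P] =
      if k = l then 1 else 0 := fun k l => by
    simp_rw [colMap_apply]
    rw [covariance_fun_sum_fun_sum (fun i => (hmem i k).const_mul _)
      (fun i => (hmem i l).const_mul _)]
    simp_rw [covariance_const_mul_left, covariance_const_mul_right, hcov]
    split_ifs with h
    · have := EuclideanSpace.norm_sq_eq z
      simp only [hz, Real.norm_eq_abs, sq_abs] at this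
      simp [h, ← pow_two, ← this]
    · simp [h]
  have hindep : iIndepFun (fun k ω => colMap (A ω) z k) P :=
    hY.iIndepFun_of_covariance_eq_zero fun k l hkl => by rw [hcovY, if_neg hkl]
  have hlaw : ∀ k, HasLaw (fun ω => colMap (A ω) z k) (gaussianReal 0 1) P := fun k => by
    have hk : HasGaussianLaw (fun ω => colMap (A ω) z k) P := hY.eval k
    refine ⟨hk.aemeasurable, ?_⟩
    rw [hk.map_eq_gaussianReal, ← covariance_self hk.aemeasurable, hcovY]
    have hmean : ∫ ω, colMap (A ω) z k ∂P = 0 := by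
      simp_rw [colMap_apply]
      rw [integral_finsetSum _ fun i _ => ((hentry i k).integrable.const_mul _)]
      refine Finset.sum_eq_zero fun i _ => ?_
      rw [integral_const_mul, (hA.hasLaw i k).integral_eq]
      simp
    simp [hmean]
  exact iIndepFun.hasLaw_pi hlaw hindep

section GaussianMatrix

variable {Ω : Type*} [MeasurableSpace Ω] {P : Measure Ω} [IsProbabilityMeasure P] {d D : ℕ}
  {A : Ω → Matrix (Fin d) (Fin D) ℝ}

lemma IsStdGaussianMatrix.measureReal_smallCount_ge_le (hA : IsStdGaussianMatrix P A)
    {z : EuclideanSpace ℝ (Fin d)} (hz : ‖z‖ = 1) {s p : ℝ} (hs : 0 ≤ s)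
    (hp : 2 * s / √(2 * Real.pi) ≤ p) (c : ℝ) :
    P.real {ω | c ≤ smallCount s (colMap (A ω) z)} ≤
      Real.exp (-c + D * ((Real.exp 1 - 1) * p)) := by
  have hS : MeasurableSet {x : ℝ | |x| < s} := measurableSet_lt (by fun_prop) measurable_const
  -- The exponential of an indicator is affine in it, so its mean is at most `1 + (e - 1) p ≤ exp
  -- ((e - 1) p)`.
  have hfun : (fun x => Real.exp (Set.indicator {x : ℝ | |x| < s} 1 x)) =
      fun x => 1 + Set.indicator {x : ℝ | |x| < s} (fun _ => Real.exp 1 - 1) x := by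
    ext x
    by_cases hx : |x| < s <;> simp [hx]
  have hint : Integrable (Set.indicator {x : ℝ | |x| < s} fun _ => Real.exp 1 - 1)
      (gaussianReal 0 1) := (integrable_const _).indicator hS
  have hval : ∫ x, Real.exp (Set.indicator {x : ℝ | |x| < s} 1 x) ∂gaussianReal 0 1 ≤
      Real.exp ((Real.exp 1 - 1) * p) := by
    rw [hfun, integral_add (integrable_const _) hint, integral_indicator_const _ hS]
    have he : 0 ≤ Real.exp 1 - 1 := by linarith [Real.add_one_le_exp (1 : ℝ)]
    have h1 := mul_le_mul_of_nonneg_left ((gaussianReal_abs_lt_le s hs).trans hp) he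
    have h2 := Real.add_one_le_exp ((Real.exp 1 - 1) * p)
    simp only [integral_const, probReal_univ, smul_eq_mul, mul_one]
    linarith
  have hmeas : MeasurableSet
      {y : Fin D → ℝ | c ≤ ∑ k, Set.indicator {x : ℝ | |x| < s} 1 (y k)} := by
    refine measurableSet_le measurable_const (Finset.measurable_sum _ fun k _ => ?_)
    exact (measurable_one.indicator hS).comp (measurable_pi_apply k)
  calc P.real {ω | c ≤ smallCount s (colMap (A ω) z)}
      = (Measure.pi fun _ : Fin D => gaussianReal 0 1).real
          {y | c ≤ ∑ k, Set.indicator {x : ℝ | |x| < s} 1 (y k)} :=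
        (hA.hasLaw_colMap hz).measureReal_eq hmeas
    _ ≤ Real.exp (-c) * (∫ x, Real.exp (Set.indicator {x : ℝ | |x| < s} 1 x)
          ∂gaussianReal 0 1) ^ Fintype.card (Fin D) :=
        measureReal_pi_ge_le _ (by rw [hfun]; exact (integrable_const _).add hint) c
    _ ≤ Real.exp (-c) * Real.exp ((Real.exp 1 - 1) * p) ^ D := by
        rw [Fintype.card_fin]
        gcongr
    _ = _ := by rw [← Real.exp_nat_mul, ← Real.exp_add]

lemma IsStdGaussianMatrix.measureReal_norm_sq_colMap_ge_le (hA : IsStdGaussianMatrix P A)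
    {z : EuclideanSpace ℝ (Fin d)} (hz : ‖z‖ = 1) :
    P.real {ω | 4 * (D : ℝ) ≤ ‖colMap (A ω) z‖ ^ 2} ≤ Real.exp (-(D : ℝ) / 2) := by
  have hmeas : MeasurableSet {y : Fin D → ℝ | (D : ℝ) ≤ ∑ k, y k ^ 2 / 4} :=
    measurableSet_le measurable_const (by fun_prop)
  obtain ⟨hint, hval⟩ := integrable_exp_sq_div_four_gaussianReal
  have hsqrt : √2 ≤ Real.exp (1 / 2) := by
    rw [Real.sqrt_le_left (Real.exp_pos _).le, ← Real.exp_nat_mul]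
    norm_num
    linarith [Real.add_one_le_exp (1 : ℝ)]
  calc P.real {ω | 4 * (D : ℝ) ≤ ‖colMap (A ω) z‖ ^ 2}
      = P.real {ω | (D : ℝ) ≤ ∑ k, colMap (A ω) z k ^ 2 / 4} := by
        congr 1
        ext ω
        simp only [Set.mem_ofPred_eq, EuclideanSpace.norm_sq_eq, Real.norm_eq_abs, sq_abs,
          ← Finset.sum_div]
        rw [le_div_iff₀' (by norm_num)]
    _ = (Measure.pi fun _ : Fin D => gaussianReal 0 1).real {y | (D : ℝ) ≤ ∑ k, y k ^ 2 / 4} :=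
        (hA.hasLaw_colMap hz).measureReal_eq hmeas
    _ ≤ Real.exp (-(D : ℝ)) * √2 ^ D := by
        have := measureReal_pi_ge_le (ι := Fin D) (gaussianReal 0 1) hint D
        rwa [hval, Fintype.card_fin] at this
    _ ≤ Real.exp (-(D : ℝ)) * Real.exp (1 / 2) ^ D := by gcongr
    _ = _ := by
        rw [← Real.exp_nat_mul, ← Real.exp_add]
        congr 1
        ring

end GaussianMatrix

/-! ### The net argument and the choice of constants. -/

lemma one_add_mul_cube_le_exp {n : ℕ} (hn : 1 ≤ n) :
    1 + 1200 * (n : ℝ) ^ 3 ≤ Real.exp (11 * (n : ℝ) ^ 2) := by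
  have hn' : (1 : ℝ) ≤ n := by exact_mod_cast hn
  have h8 : (1201 : ℝ) ≤ Real.exp 8 := by
    have h : (2.7 : ℝ) ≤ Real.exp 1 := by linarith [Real.exp_one_gt_d9]
    calc (1201 : ℝ) ≤ 2.7 ^ 8 := by norm_num
      _ ≤ Real.exp 1 ^ 8 := by gcongr
      _ = Real.exp 8 := by rw [← Real.exp_nat_mul]; norm_num
  have hexp : (n : ℝ) ^ 3 ≤ Real.exp (3 * n) := by
    have : Real.exp (3 * n) = Real.exp n ^ 3 := by rw [← Real.exp_nat_mul]; norm_num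
    rw [this]
    gcongr
    linarith [Real.add_one_le_exp (n : ℝ)]
  calc 1 + 1200 * (n : ℝ) ^ 3 ≤ 1201 * (n : ℝ) ^ 3 := by
        linarith [one_le_pow₀ (n := 3) hn']
    _ ≤ Real.exp 8 * Real.exp (3 * n) := by gcongr
    _ = Real.exp (8 + 3 * n) := (Real.exp_add _ _).symm
    _ ≤ _ := Real.exp_le_exp.2 (by nlinarith)

/-- With high probability a Gaussian matrix has operator norm `O(√D)`, and every unit vector is
nearly orthogonal to at most `(2 / 3) D / n ^ 2` of its columns. -/
lemma exists_event_colMap_bounds {d n D : ℕ} (hd : 1 ≤ d) (hn : 1 ≤ n)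
    (hD : 1100 * ((n : ℝ) ^ 4 * (d : ℝ)) ≤ (D : ℝ))
    {Ω : Type*} [MeasurableSpace Ω] (P : Measure Ω) [IsProbabilityMeasure P]
    {A : Ω → Matrix (Fin d) (Fin D) ℝ} (hA : IsStdGaussianMatrix P A) :
    ∃ G : Set Ω, 1 - Real.exp (-(8 / 81) * ((D : ℝ) / (n : ℝ) ^ 4)) ≤ P.real G ∧
      ∀ ω ∈ G, ‖colMap (A ω)‖ ≤ 4 * √(D : ℝ) ∧
        ∀ z : EuclideanSpace ℝ (Fin d), ‖z‖ = 1 →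
          smallCount (√(2 * Real.pi) / (9 * (n : ℝ) ^ 2)) (colMap (A ω) z) ≤
            2 / 3 * ((D : ℝ) / (n : ℝ) ^ 2) := by
  have hn' : (1 : ℝ) ≤ n := by exact_mod_cast hn
  have hd' : (1 : ℝ) ≤ d := by exact_mod_cast hd
  have hnpos : (0 : ℝ) < n := by linarith
  set q : ℝ := (D : ℝ) / (n : ℝ) ^ 2 with hq
  have hqd : 1100 * ((n : ℝ) ^ 2 * d) ≤ q := by
    rw [hq, le_div_iff₀ (by positivity)]
    calc _ = 1100 * ((n : ℝ) ^ 4 * (d : ℝ)) := by ring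
      _ ≤ _ := hD
  have hq1 : 1100 ≤ q := by
    have : (1 : ℝ) ≤ (n : ℝ) ^ 2 * d := one_le_mul_of_one_le_of_one_le (one_le_pow₀ hn') hd'
    linarith
  have hqD : q ≤ D := div_le_self (by positivity) (one_le_pow₀ hn')
  set t : ℝ := √(2 * Real.pi) / (9 * (n : ℝ) ^ 2) with ht
  have htpos : 0 < t := by positivity
  have htsq : t ^ 2 = 2 * Real.pi / (81 * (n : ℝ) ^ 4) := by
    rw [ht, div_pow, Real.sq_sqrt (by positivity)]
    ring
  -- With `t` of order `n ^ (-2)`, the mesh `n ^ (-3)` makes the perturbation error `D ε ^ 2 / t ^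
  -- 2` of order `D / n ^ 2 = q`.
  set ε : ℝ := 1 / (600 * (n : ℝ) ^ 3) with hε
  have hεpos : 0 < ε := by positivity
  have hεhalf : ε ≤ 1 / 2 := by
    rw [hε]
    gcongr
    linarith [one_le_pow₀ (n := 3) hn']
  obtain ⟨S, hSunit, hSnet, hScard⟩ := exists_sphere_net (E := EuclideanSpace ℝ (Fin d)) hεpos
  -- The net has size at most `exp (11 n ^ 2 d)`, and `hqd`, with its constant 1100, makes the
  -- exponent at most `q / 100`.
  have hScard' : (S.card : ℝ) ≤ Real.exp (1 / 100 * q) := by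
    calc (S.card : ℝ) ≤ (1 + 2 / ε) ^ d := by simpa using hScard
      _ = (1 + 1200 * (n : ℝ) ^ 3) ^ d := by
          congr 1
          rw [hε]
          field_simp
          ring
      _ ≤ Real.exp (11 * (n : ℝ) ^ 2) ^ d := by
          gcongr
          exact one_add_mul_cube_le_exp hn
      _ = Real.exp (d * (11 * (n : ℝ) ^ 2)) := (Real.exp_nat_mul _ _).symm
      _ ≤ _ := Real.exp_le_exp.2 (by nlinarith)
  -- The budget is `5/8 + 1/24 = 2/3`: the first term is the count on the net at the enlarged
  -- threshold `9 t / 8`, the second the passage to the sphere. At that threshold the Gaussian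
  -- estimate is exactly `1 / (4 n ^ 2)`.
  let bad : EuclideanSpace ℝ (Fin d) → Set Ω := fun z =>
    {ω | 5 / 8 * q ≤ smallCount (t + t / 8) (colMap (A ω) z)} ∪
      {ω | 4 * (D : ℝ) ≤ ‖colMap (A ω) z‖ ^ 2}
  have hbad : ∀ z ∈ S, P.real (bad z) ≤ 2 * Real.exp (-(39 / 200) * q) := fun z hz => by
    have h1 := hA.measureReal_smallCount_ge_le (hSunit z hz) (s := t + t / 8)
      (p := 1 / (4 * (n : ℝ) ^ 2)) (by positivity)
      (by
        rw [ht]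
        have : √(2 * Real.pi) ≠ 0 := by positivity
        apply le_of_eq
        field_simp
        norm_num) (5 / 8 * q)
    have h2 := hA.measureReal_norm_sq_colMap_ge_le (hSunit z hz)
    -- Since `(e - 1) / 4 ≤ 0.43`, the exponent is at most `(-0.625 + 0.43) q = -(39 / 200) q`.
    have h3 : -(5 / 8 * q) + D * ((Real.exp 1 - 1) * (1 / (4 * (n : ℝ) ^ 2))) ≤
        -(39 / 200) * q := by
      have : D * ((Real.exp 1 - 1) * (1 / (4 * (n : ℝ) ^ 2))) = (Real.exp 1 - 1) / 4 * q := by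
        rw [hq]
        field_simp
      rw [this]
      have he : (Real.exp 1 - 1) / 4 ≤ 43 / 100 := by linarith [Real.exp_one_lt_d9]
      nlinarith
    have h4 : -(D : ℝ) / 2 ≤ -(39 / 200) * q := by linarith
    calc P.real (bad z) ≤ _ := measureReal_union_le _ _
      _ ≤ Real.exp (-(39 / 200) * q) + Real.exp (-(39 / 200) * q) :=
          add_le_add (h1.trans (Real.exp_le_exp.2 h3)) (h2.trans (Real.exp_le_exp.2 h4))
      _ = _ := by ring
  have hunion : P.real (⋃ z ∈ S, bad z) ≤ Real.exp (-(8 / 81) * ((D : ℝ) / (n : ℝ) ^ 4)) := by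
    have hq4 : (D : ℝ) / (n : ℝ) ^ 4 ≤ q := by
      rw [hq]
      gcongr
      norm_num
    have htwo : (2 : ℝ) ≤ Real.exp (1 / 100 * q) := by
      linarith [Real.add_one_le_exp (1 / 100 * q)]
    calc P.real (⋃ z ∈ S, bad z) ≤ ∑ z ∈ S, P.real (bad z) := measureReal_biUnion_finset_le _ _
      _ ≤ S.card * (2 * Real.exp (-(39 / 200) * q)) := by
          rw [← nsmul_eq_mul]
          exact Finset.sum_le_card_nsmul _ _ _ hbad
      -- One factor `exp (q / 100)` pays for the net, the other for the 2; the remaining rate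
      -- `0.175` exceeds `8 / 81`.
      _ ≤ Real.exp (1 / 100 * q) * (Real.exp (1 / 100 * q) * Real.exp (-(39 / 200) * q)) := by
          gcongr
      _ = Real.exp (1 / 100 * q + (1 / 100 * q + -(39 / 200) * q)) := by
          rw [Real.exp_add, Real.exp_add]
      _ ≤ _ := Real.exp_le_exp.2 (by linarith)
  refine ⟨(⋃ z ∈ S, bad z)ᶜ, ?_, fun ω hω => ?_⟩
  -- Subadditivity suffices here, so the bad event need not be shown measurable.
  · have h := measureReal_union_le (μ := P) (⋃ z ∈ S, bad z) (⋃ z ∈ S, bad z)ᶜ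
    rw [Set.union_compl_self, probReal_univ] at h
    linarith
  · simp only [bad, Set.mem_compl_iff, Set.mem_iUnion, Set.mem_union, Set.mem_ofPred_eq, not_exists,
      not_or, not_le] at hω
    have hnorm : ‖colMap (A ω)‖ ≤ 4 * √(D : ℝ) := by
      have := opNorm_le_of_net (colMap (A ω)) (S := S) (R := 2 * √(D : ℝ)) (by positivity)
        (fun z hz => (hSnet z hz).imp fun x hx => ⟨hx.1, hx.2.trans hεhalf⟩) fun z hz => by
          refine le_of_sq_le_sq ?_ (by positivity)
          rw [mul_pow, Real.sq_sqrt (by positivity)]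
          linarith [(hω z hz).2]
      linarith
    refine ⟨hnorm, fun z hz => ?_⟩
    obtain ⟨x, hx, hzx⟩ := hSnet z hz
    have hcount := smallCount_le_add (t := t) (show 0 < t / 8 by positivity)
      (colMap (A ω) z) (colMap (A ω) x)
    have hdiff : ‖colMap (A ω) z - colMap (A ω) x‖ ^ 2 / (t / 8) ^ 2 ≤ 1 / 24 * q := by
      have h1 : ‖colMap (A ω) z - colMap (A ω) x‖ ≤ 4 * √(D : ℝ) * ε := by
        rw [← map_sub]
        exact ((colMap (A ω)).le_opNorm _).trans (by gcongr)
      calc ‖colMap (A ω) z - colMap (A ω) x‖ ^ 2 / (t / 8) ^ 2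
          ≤ (4 * √(D : ℝ) * ε) ^ 2 / (t / 8) ^ 2 := by gcongr
        _ = 1024 * 81 / (720000 * Real.pi) * q := by
            rw [mul_pow, mul_pow, Real.sq_sqrt (by positivity), div_pow t, htsq, hε, hq]
            field_simp
            ring
        _ ≤ 1 / 24 * q := by
            refine mul_le_mul_of_nonneg_right ?_ (by linarith)
            rw [div_le_div_iff₀ (by positivity) (by norm_num)]
            linarith [Real.pi_gt_three]
    linarith [(hω x hx).1]

lemma distortion_le {n d D : ℕ} {A : Matrix (Fin d) (Fin D) ℝ} {c M : ℝ} (hc : 0 < c)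
    (hM : 0 ≤ M)
    (hlow : ∀ X Y : Matrix (Fin n) (Fin d) ℝ,
      c * orbitDist X Y ≤ ‖sortEmbedding A X - sortEmbedding A Y‖)
    (hup : ∀ X Y : Matrix (Fin n) (Fin d) ℝ,
      ‖sortEmbedding A X - sortEmbedding A Y‖ ≤ M * orbitDist X Y) :
    distortion n A ≤ ENNReal.ofReal (M / c) := by
  have h1 : ENNReal.ofReal c ≤ lowerLipschitzConst n A :=
    le_iSup₂_of_le c.toNNReal (by simpa [hc.le] using hlow) le_rfl
  have h2 : upperLipschitzConst n A ≤ ENNReal.ofReal M :=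
    iInf₂_le_of_le M.toNNReal (by simpa [hM] using hup) le_rfl
  have hne : lowerLipschitzConst n A ≠ 0 := ((ENNReal.ofReal_pos.2 hc).trans_le h1).ne'
  rw [distortion, if_neg hne, ENNReal.ofReal_div_of_pos hc]
  exact ENNReal.div_le_div h2 h1

theorem theorem3p4 :
    ∃ C K c₁ c₂ : ℝ, 0 < C ∧ 0 < K ∧ 0 < c₁ ∧ 0 < c₂ ∧
      ∀ d n D : ℕ, 1 ≤ d → 1 ≤ n → 1 ≤ D → C * ((n : ℝ) ^ 4 * (d : ℝ)) ≤ (D : ℝ) →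
        ∀ (Ω : Type*) [MeasurableSpace Ω] (P : Measure Ω) [IsProbabilityMeasure P]
          (A : Ω → Matrix (Fin d) (Fin D) ℝ), IsStdGaussianMatrix P A →
          1 - Real.exp (-(8 / 81) * ((D : ℝ) / (n : ℝ) ^ 4)) ≤
            P.real {ω | ∀ X Y : Matrix (Fin n) (Fin d) ℝ,
              √(2 * Real.pi) / (9 * √3) * (√(D : ℝ) / (n : ℝ) ^ 2) * orbitDist X Y ≤
                ‖sortEmbedding (A ω) X - sortEmbedding (A ω) Y‖} ∧
          1 - 2 * Real.exp (-c₁ * (D : ℝ)) - Real.exp (-c₂ * ((D : ℝ) / (n : ℝ) ^ 4)) ≤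
            P.real {ω | distortion n (A ω) ≤ ENNReal.ofReal (K * (n : ℝ) ^ 2)} := by
  -- `K` is the quotient of the upper constant `4 √D` and the lower constant, without `n ^ 2`. The
  -- choice of `c₁` is immaterial: the event `G` already has probability at least `1 - exp (-(8 /
  -- 81) D / n ^ 4)`.
  refine ⟨1100, 4 * (9 * √3) / √(2 * Real.pi), 1, 8 / 81, by norm_num, by positivity, one_pos,
    by norm_num, fun d n D hd hn hD1 hD Ω _ P _ A hA => ?_⟩
  obtain ⟨G, hG, hGω⟩ := exists_event_colMap_bounds hd hn hD P hA
  have hn0 : (0 : ℝ) < n := by exact_mod_cast hn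
  have hD0 : (0 : ℝ) < D := by exact_mod_cast hD1
  have hlow : ∀ ω ∈ G, ∀ X Y : Matrix (Fin n) (Fin d) ℝ,
      √(2 * Real.pi) / (9 * √3) * (√(D : ℝ) / (n : ℝ) ^ 2) * orbitDist X Y ≤
        ‖sortEmbedding (A ω) X - sortEmbedding (A ω) Y‖ := fun ω hω X Y => by
    convert sqrt_mul_orbitDist_le hn (A ω) (by positivity) (hGω ω hω).2 X Y using 2
    rw [Real.sqrt_div hD0.le]
    field_simp
  refine ⟨hG.trans (measureReal_mono fun ω hω => hlow ω hω), ?_⟩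
  have hdist : P.real G ≤
      P.real {ω | distortion n (A ω) ≤
        ENNReal.ofReal (4 * (9 * √3) / √(2 * Real.pi) * (n : ℝ) ^ 2)} := by
    refine measureReal_mono fun ω hω => ?_
    refine (distortion_le (by positivity) (by positivity) (hlow ω hω) fun X Y =>
      (norm_sortEmbedding_sub_le (A ω) X Y).trans
        (mul_le_mul_of_nonneg_right (hGω ω hω).1 (orbitDist_nonneg X Y))).trans_eq ?_
    congr 1
    field_simp
  linarith [Real.exp_pos (-1 * (D : ℝ))]
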